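/- Let $\Bbbk=\mathbb{R}$ or $\mathbb{C}$, and let $\mathbb{S}^n_+(\Bbbk)$ be the cone of positive semidefinite $n\times n$ real symmetric (if $\Bbbk=\mathbb{R}$) or complex Hermitian (if $\Bbbk=\mathbb{C}$) matrices. For $d\in\mathbb{N}$, $d\ge 1$, and $A=(a_{ij})\in\Bbbk^{n\times n}$ put $$\lVert A\rVert_{\gamma,d}^{\Bbbk}=\max\Bigl\{\Bigl|\sum_{i=1}^n\sum_{j=1}^n a_{ij}\langle x_i,x_j\rangle\Bigr| : x_1,\dots,x_n\in\Bbbk^d,\ \lVert x_1\rVert=\dots=\lVert x_n\rVert=1\Bigr\},$$ where $\langle x,y\rangle=x^*y$, and $\lVert A\rVert_\gamma^{\Bbbk}=\lVert A\rVert_{\gamma,n}^{\Bbbk}$. For integers $1\le d\le p$ let $$K_{\mathsf{C},d,p}^{\Bbbk}=\sup_{n\in\mathbb{N}}\ \sup_{0\ne A\in\mathbb{S}^n_+(\Bbbk)}\frac{\lVert A\rVert_{\gamma,p}^{\Bbbk}}{\lVert A\rVert_{\gamma,d}^{\Bbbk}},\qquad K_{\mathsf{C},d,\infty}^{\Bbbk}=\lim_{p\to\infty}K_{\mathsf{C},d,p}^{\Bbbk}.$$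 **Proposition.** For all integers $1\le d\le p$, $$K_{\mathsf{C},d,p}^{\mathbb{R}}\ge\frac{d}{p}\left[\frac{\Gamma\bigl(\frac{p+1}{2}\bigr)\Gamma\bigl(\frac d2\bigr)}{\Gamma\bigl(\frac p2\bigr)\Gamma\bigl(\frac{d+1}{2}\bigr)}\right]^2,\qquad K_{\mathsf{C},d,p}^{\mathbb{C}}\ge\frac{d}{p}\left[\frac{\Gamma\bigl(\frac{2p+1}{2}\bigr)\Gamma(d)}{\Gamma(p)\Gamma\bigl(\frac{2d+1}{2}\bigr)}\right]^2.$$ Furthermore, for every fixed integer $d\ge1$ the limits $K_{\mathsf{C},d,\infty}^{\Bbbk}$ exist and $$K_{\mathsf{C},d,\infty}^{\mathbb{R}}=\frac{d\,\Gamma(d/2)^2}{2\,\Gamma\bigl((d+1)/2\bigr)^2},\qquad K_{\mathsf{C},d,\infty}^{\mathbb{C}}=\frac{d\,\Gamma(d)^2}{\Gamma\bigl((2d+1)/2\bigr)^2}.$$ Consequently, for all integers $d\ge1$, $n\ge 1$ and all $A\in\mathbb{S}^n_+(\Bbbk)$, $$\lVert A\rVert_\gamma^{\Bbbk}\le K_{\mathsf{C},d,\infty}^{\Bbbk}\,\lVert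 A\rVert_{\gamma,d}^{\Bbbk}$$ with the above values of the constant. For $d=1$ the constants are $K_{\mathsf{C},1,\infty}^{\mathbb{R}}=\pi/2$ and $K_{\mathsf{C},1,\infty}^{\mathbb{C}}=4/\pi$, so that this inequality contains the Nesterov $\pi/2$-Theorem and the Ben-Tal--Nemirovski--Roos $4/\pi$-Theorem. -/

import Mathlib

open Filter Topology
open scoped ENNReal

/-- The `(γ, d)`-seminorm of an `n × n` matrix over `𝕜 = ℝ` or `ℂ`: the maximum of
`|∑ i, ∑ j, a i j * ⟨x i, x j⟩|` over all unit vectors `x 1, …, x n` of `𝕜 ^ d`. For `1 ≤ d` the set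
below is the image of a nonempty compact set under a continuous map, so that its supremum is
a maximum. The inner product is conjugate-linear in the first argument: `⟨x, y⟩ = x* y`. -/
noncomputable def gammaSeminorm {𝕜 : Type*} [RCLike 𝕜] {n : ℕ} (d : ℕ)
    (A : Matrix (Fin n) (Fin n) 𝕜) : ℝ :=
  sSup {r : ℝ | ∃ x : Fin n → EuclideanSpace 𝕜 (Fin d),
    (∀ i, ‖x i‖ = 1) ∧ r = ‖∑ i, ∑ j, A i j * inner 𝕜 (x i) (x j)‖}

/-- The `γ`-seminorm of an `n × n` matrix: the `(γ, n)`-seminorm. -/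
noncomputable def gammaSeminormFull {𝕜 : Type*} [RCLike 𝕜] {n : ℕ}
    (A : Matrix (Fin n) (Fin n) 𝕜) : ℝ :=
  gammaSeminorm n A

open scoped ComplexOrder in
/-- The family of cones of positive semidefinite (real symmetric or complex Hermitian)
`n × n` matrices, `n ∈ ℕ`. -/
def psdCones (𝕜 : Type*) [RCLike 𝕜] (n : ℕ) : Set (Matrix (Fin n) (Fin n) 𝕜) :=
  {A | A.PosSemidef}

/-- The conic Grothendieck constant `K_{C,d,p}` of a family of cones `C n`: the supremum over all
`n` and all `A ∈ C n` of the ratio of the `(γ, p)`-seminorm to the `(γ, d)`-seminorm of `A`.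
It is taken in `[0, ∞]`, where `0 / 0 = 0` (so that `A = 0` does not contribute) and `a / 0 = ∞`
for `a ≠ 0`. -/
noncomputable def conicConst {𝕜 : Type*} [RCLike 𝕜] (C : ∀ n : ℕ, Set (Matrix (Fin n) (Fin n) 𝕜))
    (d p : ℕ) : ℝ≥0∞ :=
  ⨆ n : ℕ, ⨆ A ∈ C n, ENNReal.ofReal (gammaSeminorm p A) / ENNReal.ofReal (gammaSeminorm d A)

/-!
Write `k = dim_ℝ 𝕜` and `ρ_N = (𝔼 ‖g‖)² / 𝔼 ‖g‖²` for a standard Gaussian `g` in `ℝ^N`.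

*Upper bound.* Given unit vectors `x i` in `𝕜^p`, let `G` be a Gaussian `d × p` matrix, so that
`v i = G (x i)` are Gaussian in `𝕜^d`, and let `u i` be their directions. By rotation invariance
`𝔼 ⟨u i, v j⟩` and `𝔼 ⟨v i, v j⟩` are constant multiples of `⟨x i, x j⟩`. For a positive
semidefinite `A`, expanding `0 ≤ 𝔼 ∑ A i j ⟨u i - α v i, u j - α v j⟩` with the optimal `α` gives
`ρ_{kd} ‖A‖_{γ,p} ≤ ‖A‖_{γ,d}`.

*Lower bound.* Discretize the Gaussian on `𝕜^p` into finitely many vectors `v i` with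
`∑ f (v i) ≈ 𝔼 f g` for all seminorms `f` that are Lipschitz with a common constant, and let `A`
be the (transposed) Gram matrix of the `v i`. Then `∑ A i j ⟨x i, x j⟩ = ‖M‖²` for the matrix
`M = ∑ (x i) (v i)*`. Taking for `x i` the direction of `v i` shows
`‖A‖_{γ,p} ≥ (𝔼 ‖g‖)² / p`, up to an error. For unit vectors `x i` in `𝕜^d`,
`‖M‖² ≤ ∑ ‖M (v i)‖ ≈ 𝔼 ‖M g‖`, and among operators of given Frobenius norm into a
`kd`-dimensional space this mean is largest for multiples of a coisometry, so that
`‖A‖_{γ,d} ≤ k ρ_{kd}`, up to an error. Hence `K_{C,d,p} ≥ ρ_{kp} / ρ_{kd}`, and `ρ_N → 1`.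
-/

open MeasureTheory ProbabilityTheory

/-- The mean Euclidean norm of a standard Gaussian vector in `ℝ^N`. -/
noncomputable def gaussMeanNorm (N : ℕ) : ℝ :=
  √2 * Real.Gamma ((N + 1) / 2) / Real.Gamma (N / 2)

/-- The ratio `(𝔼 ‖g‖)² / 𝔼 ‖g‖²` of a standard Gaussian vector `g` in `ℝ^N`, where
`𝔼 ‖g‖² = N`; the inverse of its value at `N = d * dim_ℝ 𝕜` is the conic constant `K_{C,d,∞}`. -/
noncomputable def gaussRatio (N : ℕ) : ℝ :=
  gaussMeanNorm N ^ 2 / N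

lemma gaussMeanNorm_pos {N : ℕ} (hN : 0 < N) : 0 < gaussMeanNorm N :=
  div_pos (mul_pos (by positivity) (Real.Gamma_pos_of_pos (by positivity)))
    (Real.Gamma_pos_of_pos (by positivity))

lemma gaussRatio_pos {N : ℕ} (hN : 0 < N) : 0 < gaussRatio N :=
  div_pos (pow_pos (gaussMeanNorm_pos hN) 2) (by positivity)

section Polar

variable {E : Type*} [NormedAddCommGroup E] [NormedSpace ℝ E] [FiniteDimensional ℝ E]
  [Nontrivial E] [MeasurableSpace E] [BorelSpace E]

lemma integral_norm_mul_normalize (μ : Measure E) [μ.IsAddHaarMeasure] (h : ℝ → ℝ) (k : E → ℝ) :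
    ∫ x, h ‖x‖ * k (NormedSpace.normalize x) ∂μ =
      (∫ θ, k θ ∂μ.toSphere) * ∫ r in Set.Ioi 0, r ^ (Module.finrank ℝ E - 1) * h r :=
  calc
    ∫ x, h ‖x‖ * k (NormedSpace.normalize x) ∂μ
        = ∫ x : ({0}ᶜ : Set E), h ‖x.1‖ * k (NormedSpace.normalize x.1) ∂(μ.comap (↑)) := by
      rw [integral_subtype_comap (measurableSet_singleton _).compl
        fun x ↦ h ‖x‖ * k (NormedSpace.normalize x), restrict_compl_singleton]
    _ = ∫ z, k z.1 * h z.2 ∂μ.toSphere.prod (.volumeIoiPow (Module.finrank ℝ E - 1)) := by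
      simpa [NormedSpace.normalize, mul_comm] using
        μ.measurePreserving_homeomorphUnitSphereProd.integral_comp
          (Homeomorph.measurableEmbedding _) fun z ↦ k z.1 * h z.2
    _ = (∫ θ, k θ ∂μ.toSphere) *
          ∫ r : Set.Ioi (0 : ℝ), h r ∂.volumeIoiPow (Module.finrank ℝ E - 1) :=
      integral_prod_mul (fun θ : Metric.sphere (0 : E) 1 ↦ k θ) fun r : Set.Ioi (0 : ℝ) ↦ h r
    _ = _ := by
      congr 1
      rw [Measure.volumeIoiPow,
        integral_withDensity_eq_integral_toReal_smul (by fun_prop) (by simp),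
        ← integral_subtype_comap measurableSet_Ioi]
      exact integral_congr_ae (.of_forall fun r ↦ by
        simp [ENNReal.toReal_ofReal (pow_nonneg r.2.out.le _)])

end Polar

lemma integral_Ioi_pow_mul_pow_mul_exp {N : ℕ} (hN : 0 < N) (q : ℕ) :
    ∫ r in Set.Ioi (0 : ℝ), r ^ (N - 1) * (r ^ q * Real.exp (-(1 / 2) * r ^ 2)) =
      √2 ^ (N + q) / 2 * Real.Gamma ((N + q) / 2) := by
  have h := integral_rpow_mul_exp_neg_mul_rpow (p := 2) (q := (N - 1 + q : ℕ)) (b := 1 / 2)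
    (by norm_num) (lt_of_lt_of_le (by norm_num) (Nat.cast_nonneg _)) (by norm_num)
  have hcast : ((N - 1 + q : ℕ) : ℝ) + 1 = ((N + q : ℕ) : ℝ) := by
    rw [← Nat.cast_add_one]
    congr 1
    lia
  calc
    _ = ∫ r in Set.Ioi (0 : ℝ), r ^ ((N - 1 + q : ℕ) : ℝ) * Real.exp (-(1 / 2) * r ^ (2 : ℝ)) :=
      setIntegral_congr_fun measurableSet_Ioi fun r _ ↦ by
        simp only [Real.rpow_natCast, Real.rpow_two, ← mul_assoc, ← pow_add]
    _ = (1 / 2 : ℝ) ^ (-((N + q : ℕ) : ℝ) / 2) * (1 / 2) * Real.Gamma ((N + q : ℕ) / 2) := by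
      rw [h, hcast]
    _ = _ := by
      have hpow : (1 / 2 : ℝ) ^ (-((N + q : ℕ) : ℝ) / 2) = √2 ^ (N + q) := by
        rw [one_div, Real.inv_rpow zero_le_two, ← Real.rpow_neg zero_le_two, neg_div, neg_neg,
          ← Real.rpow_natCast, Real.sqrt_eq_rpow, ← Real.rpow_mul zero_le_two]
        ring_nf
      rw [hpow]
      push_cast
      ring

section

variable {E F : Type*} [NormedAddCommGroup E] [InnerProductSpace ℝ E] [FiniteDimensional ℝ E]
  [NormedAddCommGroup F] [InnerProductSpace ℝ F]

lemma exists_isometryEquiv_of_adjoint_isometry {P : E →L[ℝ] F} {ι : F →ₗᵢ[ℝ] E}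
    (hPι : ∀ x t, inner ℝ (P x) t = inner ℝ x (ι t)) :
    ∃ R : E ≃ₗᵢ[ℝ] E, ∀ x, P (R x) = P x ∧ R x + x = ι (P x) + ι (P x) := by
  set R := (LinearMap.range ι.toLinearMap).reflection
  have hPι_id (y : F) : P (ι y) = y := ext_inner_right ℝ fun t ↦ by
    rw [hPι, ι.inner_map_map]
  have hproj (x : E) : (LinearMap.range ι.toLinearMap).starProjection x = ι (P x) := by
    refine Submodule.eq_starProjection_of_mem_of_inner_eq_zero ⟨P x, rfl⟩ ?_
    rintro _ ⟨t, rfl⟩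
    change inner ℝ (x - ι (P x)) (ι t) = 0
    rw [inner_sub_left, ι.inner_map_map, hPι, sub_self]
  have hR (x : E) : R x = ι (P x) + ι (P x) - x := by
    rw [Submodule.reflection_apply, hproj, two_smul]
  refine ⟨R, fun x ↦ ⟨?_, by rw [hR, sub_add_cancel]⟩⟩
  rw [hR, map_sub, map_add, hPι_id, add_sub_cancel_right]

end

section StdGaussian

variable (E : Type*) [NormedAddCommGroup E] [InnerProductSpace ℝ E] [FiniteDimensional ℝ E]
  [MeasurableSpace E] [BorelSpace E]

lemma integrable_exp_neg_half_mul_norm_sq :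
    Integrable fun x : E ↦ Real.exp (-(1 / 2) * ‖x‖ ^ 2) := by
  have h := GaussianFourier.integrable_cexp_neg_mul_sq_norm_add (V := E) (b := 1 / 2)
    (by norm_num) 0 0
  exact h.norm.congr (.of_forall fun x ↦ by simp [Complex.norm_exp, ← Complex.ofReal_pow])

lemma stdGaussian_eq_withDensity :
    stdGaussian E = volume.withDensity fun x ↦ ENNReal.ofReal
      ((∫ y : E, Real.exp (-(1 / 2) * ‖y‖ ^ 2))⁻¹ * Real.exp (-(1 / 2) * ‖x‖ ^ 2)) := by
  have hint := integrable_exp_neg_half_mul_norm_sq E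
  set Z := ∫ y : E, Real.exp (-(1 / 2) * ‖y‖ ^ 2) with hZ
  have hZ_pos : 0 < Z := integral_exp_pos hint
  have hZ_eq : (Z : ℂ) = (Real.pi / (1 / 2 : ℂ)) ^ (Module.finrank ℝ E / 2 : ℂ) := by
    rw [← GaussianFourier.integral_cexp_neg_mul_sq_norm (by norm_num), hZ,
      ← integral_complex_ofReal]
    push_cast
    rfl
  have : IsFiniteMeasure (volume.withDensity fun x : E ↦
      ENNReal.ofReal (Z⁻¹ * Real.exp (-(1 / 2) * ‖x‖ ^ 2))) :=
    isFiniteMeasure_withDensity_ofReal (hint.const_mul _).2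
  refine Measure.ext_of_charFun (funext fun t ↦ ?_)
  rw [charFun_stdGaussian, charFun_apply,
    integral_withDensity_eq_integral_toReal_smul (by fun_prop) (by simp)]
  calc
    _ = (Z : ℂ)⁻¹ * ∫ x : E, Complex.exp (-(1 / 2) * ‖x‖ ^ 2 + Complex.I * inner ℝ t x) := by
      rw [GaussianFourier.integral_cexp_neg_mul_sq_norm_add (by norm_num), ← hZ_eq, ← mul_assoc,
        inv_mul_cancel₀ (by exact_mod_cast hZ_pos.ne'), one_mul, Complex.I_sq]
      congr 1
      ring
    _ = _ := by
      rw [← integral_const_mul]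
      refine integral_congr_ae (.of_forall fun x ↦ ?_)
      dsimp only
      rw [ENNReal.toReal_ofReal (by positivity), Complex.real_smul, Complex.exp_add,
        real_inner_comm]
      push_cast
      ring_nf

variable {E}

lemma integral_norm_pow_mul_normalize_stdGaussian [Nontrivial E] (q : ℕ) (k : E → ℝ) :
    ∫ x, ‖x‖ ^ q * k (NormedSpace.normalize x) ∂stdGaussian E =
      √2 ^ q * Real.Gamma ((Module.finrank ℝ E + q) / 2) / Real.Gamma (Module.finrank ℝ E / 2) *
        ∫ x, k (NormedSpace.normalize x) ∂stdGaussian E := by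
  have hN : 0 < Module.finrank ℝ E := Module.finrank_pos
  set Z := ∫ y : E, Real.exp (-(1 / 2) * ‖y‖ ^ 2)
  have hpolar (q : ℕ) (k : E → ℝ) : ∫ x, ‖x‖ ^ q * k (NormedSpace.normalize x) ∂stdGaussian E =
      Z⁻¹ * (∫ θ, k θ ∂(volume : Measure E).toSphere) *
        (√2 ^ (Module.finrank ℝ E + q) / 2 * Real.Gamma ((Module.finrank ℝ E + q) / 2)) := by
    rw [stdGaussian_eq_withDensity,
      integral_withDensity_eq_integral_toReal_smul (by fun_prop) (by simp),
      ← integral_Ioi_pow_mul_pow_mul_exp hN, mul_assoc,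
      ← integral_norm_mul_normalize volume (fun r ↦ r ^ q * Real.exp (-(1 / 2) * r ^ 2)),
      ← integral_const_mul]
    refine integral_congr_ae (.of_forall fun x ↦ ?_)
    dsimp only
    rw [ENNReal.toReal_ofReal (by positivity), smul_eq_mul]
    ring
  have hΓ : Real.Gamma (Module.finrank ℝ E / 2) ≠ 0 := (Real.Gamma_pos_of_pos (by positivity)).ne'
  have h0 := hpolar 0 k
  simp only [pow_zero, one_mul, Nat.cast_zero, add_zero] at h0
  rw [hpolar, h0, pow_add]
  field_simp

lemma integral_norm_mul_normalize_stdGaussian [Nontrivial E] (k : E → ℝ) :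
    ∫ x, ‖x‖ * k (NormedSpace.normalize x) ∂stdGaussian E =
      gaussMeanNorm (Module.finrank ℝ E) * ∫ x, k (NormedSpace.normalize x) ∂stdGaussian E := by
  simpa [gaussMeanNorm] using integral_norm_pow_mul_normalize_stdGaussian 1 k

lemma integral_norm_sq_mul_normalize_stdGaussian [Nontrivial E] (k : E → ℝ) :
    ∫ x, ‖x‖ ^ 2 * k (NormedSpace.normalize x) ∂stdGaussian E =
      Module.finrank ℝ E * ∫ x, k (NormedSpace.normalize x) ∂stdGaussian E := by
  have hN : 0 < (Module.finrank ℝ E / 2 : ℝ) := by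
    have : 0 < Module.finrank ℝ E := Module.finrank_pos
    positivity
  rw [integral_norm_pow_mul_normalize_stdGaussian, Nat.cast_two, add_div, div_self two_ne_zero,
    Real.Gamma_add_one hN.ne', Real.sq_sqrt zero_le_two]
  have hΓ : Real.Gamma (Module.finrank ℝ E / 2) ≠ 0 := (Real.Gamma_pos_of_pos hN).ne'
  field_simp

variable (E) in
lemma integral_norm_stdGaussian [Nontrivial E] :
    ∫ x, ‖x‖ ∂stdGaussian E = gaussMeanNorm (Module.finrank ℝ E) := by
  simpa using integral_norm_mul_normalize_stdGaussian (E := E) fun _ ↦ 1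

variable (E) in
lemma integral_norm_sq_stdGaussian [Nontrivial E] :
    ∫ x, ‖x‖ ^ 2 ∂stdGaussian E = Module.finrank ℝ E := by
  simpa using integral_norm_sq_mul_normalize_stdGaussian (E := E) fun _ ↦ 1

variable {F : Type*} [NormedAddCommGroup F] [InnerProductSpace ℝ F]

lemma sq_integral_norm_clm_le_of_nontrivial [Nontrivial E] (T : E →L[ℝ] F) :
    (∫ x, ‖T x‖ ∂stdGaussian E) ^ 2 ≤
      gaussRatio (Module.finrank ℝ E) * ∫ x, ‖T x‖ ^ 2 ∂stdGaussian E := by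
  have hN : 0 < Module.finrank ℝ E := Module.finrank_pos
  have hT (x : E) : ‖T x‖ = ‖x‖ * ‖T (NormedSpace.normalize x)‖ := by
    conv_lhs => rw [← NormedSpace.norm_smul_normalize x, map_smul, norm_smul, norm_norm]
  have hθ_norm (x : E) : ‖NormedSpace.normalize x‖ ≤ 1 := by
    rw [NormedSpace.normalize, norm_smul, norm_inv, norm_norm]
    exact inv_mul_le_one
  have hθ_meas : Measurable (NormedSpace.normalize : E → E) :=
    measurable_norm.inv.smul measurable_id
  have hθ : MemLp (fun x : E ↦ ‖T (NormedSpace.normalize x)‖) 2 (stdGaussian E) :=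
    .of_bound (by fun_prop) ‖T‖ (.of_forall fun x ↦ by
      simpa using T.le_opNorm_of_le (hθ_norm x))
  have hjensen : (∫ x, ‖T (NormedSpace.normalize x)‖ ∂stdGaussian E) ^ 2 ≤
      ∫ x, ‖T (NormedSpace.normalize x)‖ ^ 2 ∂stdGaussian E := by
    have := variance_nonneg (fun x : E ↦ ‖T (NormedSpace.normalize x)‖) (stdGaussian E)
    rw [variance_eq_sub hθ, sub_nonneg] at this
    exact this
  calc
    _ = gaussMeanNorm (Module.finrank ℝ E) ^ 2 *
          (∫ x, ‖T (NormedSpace.normalize x)‖ ∂stdGaussian E) ^ 2 := by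
      rw [← mul_pow, ← integral_norm_mul_normalize_stdGaussian fun x ↦ ‖T x‖]
      simp only [← hT]
    _ ≤ gaussMeanNorm (Module.finrank ℝ E) ^ 2 *
          ∫ x, ‖T (NormedSpace.normalize x)‖ ^ 2 ∂stdGaussian E := by
      gcongr
    _ = gaussRatio (Module.finrank ℝ E) *
          (Module.finrank ℝ E * ∫ x, ‖T (NormedSpace.normalize x)‖ ^ 2 ∂stdGaussian E) := by
      rw [gaussRatio]
      field_simp
    _ = _ := by
      rw [← integral_norm_sq_mul_normalize_stdGaussian fun x ↦ ‖T x‖ ^ 2]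
      simp only [← mul_pow, ← hT]

lemma stdGaussian_map_of_adjoint_isometry [FiniteDimensional ℝ F] [MeasurableSpace F]
    [BorelSpace F] {P : E →L[ℝ] F} {ι : F →ₗᵢ[ℝ] E}
    (hPι : ∀ x t, inner ℝ (P x) t = inner ℝ x (ι t)) :
    (stdGaussian E).map P = stdGaussian F := by
  have : IsProbabilityMeasure ((stdGaussian E).map P) :=
    Measure.isProbabilityMeasure_map (by fun_prop)
  refine Measure.ext_of_charFun (funext fun t ↦ ?_)
  rw [charFun_apply, integral_map (by fun_prop) (by fun_prop)]
  simp_rw [hPι]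
  rw [← charFun_apply, charFun_stdGaussian, charFun_stdGaussian, ι.norm_map]

lemma stdGaussian_map_orthogonalProjectionOnto (W : Submodule ℝ E) :
    (stdGaussian E).map W.orthogonalProjectionOnto = stdGaussian W :=
  stdGaussian_map_of_adjoint_isometry (ι := W.subtypeₗᵢ) fun x t ↦
    W.inner_orthogonalProjectionOnto_eq_of_mem_right t x

lemma gaussRatio_finrank_le_finrank [FiniteDimensional ℝ F] {W : Submodule ℝ F} (hW : W ≠ ⊥) :
    gaussRatio (Module.finrank ℝ W) ≤ gaussRatio (Module.finrank ℝ F) := by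
  borelize F
  have : Nontrivial W := Submodule.nontrivial_iff_ne_bot.2 hW
  have : Nontrivial F := W.subtype_injective.nontrivial
  have hdim : (0 : ℝ) < Module.finrank ℝ W := by exact_mod_cast Module.finrank_pos
  have h := sq_integral_norm_clm_le_of_nontrivial W.orthogonalProjectionOnto
  rwa [← integral_map (φ := W.orthogonalProjectionOnto) (f := fun w : W ↦ ‖w‖) (by fun_prop)
      (by fun_prop), ← integral_map (φ := W.orthogonalProjectionOnto) (f := fun w : W ↦ ‖w‖ ^ 2)
      (by fun_prop) (by fun_prop), stdGaussian_map_orthogonalProjectionOnto,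
    integral_norm_stdGaussian, integral_norm_sq_stdGaussian, ← div_le_iff₀ hdim] at h

lemma sq_integral_norm_clm_le [FiniteDimensional ℝ F] (T : E →L[ℝ] F) :
    (∫ x, ‖T x‖ ∂stdGaussian E) ^ 2 ≤
      gaussRatio (Module.finrank ℝ F) * ∫ x, ‖T x‖ ^ 2 ∂stdGaussian E := by
  rcases eq_or_ne T 0 with rfl | hT
  · simp
  set W := T.kerᗮ
  have hW_finrank : Module.finrank ℝ W = Module.finrank ℝ T.range := by
    have h₁ := T.toLinearMap.finrank_range_add_finrank_ker
    have h₂ := T.ker.finrank_add_finrank_orthogonal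
    linarith
  have hT_range : T.range ≠ ⊥ := by
    exact fun h ↦ hT (ContinuousLinearMap.coe_injective (LinearMap.range_eq_bot.1 h))
  have : Nontrivial W := Module.nontrivial_of_finrank_pos (R := ℝ) <|
    hW_finrank ▸ Module.finrank_pos_iff.2 (Submodule.nontrivial_iff_ne_bot.2 hT_range)
  have hT_proj (x : E) : T x = T (W.orthogonalProjectionOnto x) := by
    have hker : T (T.ker.starProjection x) = 0 := T.ker.starProjection_apply_mem x
    conv_lhs => rw [← T.ker.starProjection_add_starProjection_orthogonal x, map_add, hker, zero_add]
    rfl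
  have hmap (f : F → ℝ) (hf : Continuous f) : ∫ x, f (T x) ∂stdGaussian E =
      ∫ w : W, f (T w) ∂stdGaussian W := by
    rw [← stdGaussian_map_orthogonalProjectionOnto, integral_map (by fun_prop) (by fun_prop)]
    simp only [← hT_proj]
  rw [hmap _ continuous_norm, hmap (fun y ↦ ‖y‖ ^ 2) (by fun_prop)]
  calc
    _ ≤ gaussRatio (Module.finrank ℝ W) * ∫ w : W, ‖T w‖ ^ 2 ∂stdGaussian W :=
      sq_integral_norm_clm_le_of_nontrivial (T.comp W.subtypeL)
    _ ≤ _ := by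
      rw [hW_finrank]
      gcongr
      exact gaussRatio_finrank_le_finrank hT_range

section Regression

variable {𝕜 G : Type*} [RCLike 𝕜] [NormedAddCommGroup G] [InnerProductSpace 𝕜 G]
  {P : E →L[ℝ] F} {ι : F →ₗᵢ[ℝ] E}

lemma integrable_inner_of_memLp_two {Ω : Type*} [MeasurableSpace Ω] {μ : Measure Ω} {f g : Ω → G}
    (hf : MemLp f 2 μ) (hg : MemLp g 2 μ) : Integrable (fun ω ↦ inner 𝕜 (f ω) (g ω)) μ :=
  (hf.norm.integrable_mul hg.norm).mono (hf.1.inner hg.1) <| .of_forall fun ω ↦ by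
    simpa using norm_inner_le_norm (𝕜 := 𝕜) (f ω) (g ω)

variable [NormedSpace ℝ G] [FiniteDimensional ℝ F] [MeasurableSpace F] [BorelSpace F]

-- The reflection in the range of `ι` preserves the Gaussian measure and `P`, and it averages
-- `T` to `T ∘ ι ∘ P`.
lemma integral_inner_comp_eq_of_adjoint_isometry
    (hPι : ∀ x t, inner ℝ (P x) t = inner ℝ x (ι t)) (T : E →L[ℝ] G) {φ : F → G}
    (hφ : MemLp φ 2 (stdGaussian F)) :
    ∫ x, inner 𝕜 (φ (P x)) (T x) ∂stdGaussian E =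
      ∫ y, inner 𝕜 (φ y) (T (ι y)) ∂stdGaussian F := by
  obtain ⟨R, hR⟩ := exists_isometryEquiv_of_adjoint_isometry hPι
  have hmap := stdGaussian_map_of_adjoint_isometry hPι
  have hφP : MemLp (fun x ↦ φ (P x)) 2 (stdGaussian E) :=
    (hmap ▸ hφ).comp_of_map (by fun_prop)
  have hint (S : E →L[ℝ] G) : Integrable (fun x ↦ inner 𝕜 (φ (P x)) (S x)) (stdGaussian E) :=
    integrable_inner_of_memLp_two hφP (S.comp_memLp' IsGaussian.memLp_two_id)
  have hint_ι : Integrable (fun x ↦ inner 𝕜 (φ (P x)) (T (ι (P x)))) (stdGaussian E) :=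
    hint (T.comp (ι.toContinuousLinearMap.comp P))
  have hint_R : Integrable (fun x ↦ inner 𝕜 (φ (P x)) (T (R x))) (stdGaussian E) :=
    hint (T.comp (R : E →L[ℝ] E))
  have hreflect : ∫ x, inner 𝕜 (φ (P x)) (T (R x)) ∂stdGaussian E =
      ∫ x, inner 𝕜 (φ (P x)) (T x) ∂stdGaussian E := by
    have hR_pres : MeasurePreserving R (stdGaussian E) (stdGaussian E) :=
      ⟨R.continuous.measurable, stdGaussian_map R⟩
    simpa only [(hR _).1] using hR_pres.integral_comp R.toHomeomorph.measurableEmbedding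
      fun x ↦ inner 𝕜 (φ (P x)) (T x)
  have hpush : ∫ x, inner 𝕜 (φ (P x)) (T (ι (P x))) ∂stdGaussian E =
      ∫ y, inner 𝕜 (φ y) (T (ι y)) ∂stdGaussian F := by
    rw [← hmap, integral_map (by fun_prop)]
    exact hmap ▸ hφ.1.inner (T.continuous.comp ι.continuous).aestronglyMeasurable
  have hsum : ∫ x, inner 𝕜 (φ (P x)) (T (R x)) ∂stdGaussian E +
        ∫ x, inner 𝕜 (φ (P x)) (T x) ∂stdGaussian E =
      ∫ x, inner 𝕜 (φ (P x)) (T (ι (P x))) ∂stdGaussian E +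
        ∫ x, inner 𝕜 (φ (P x)) (T (ι (P x))) ∂stdGaussian E := by
    rw [← integral_add hint_R (hint T), ← integral_add hint_ι hint_ι]
    simp only [← inner_add_right, ← map_add, hR]
  rw [hreflect, hpush] at hsum
  linear_combination hsum / 2

end Regression

end StdGaussian

section Discretization

variable {E : Type*} [NormedAddCommGroup E] [NormedSpace ℝ E]

lemma abs_seminorm_sub_le {f : Seminorm ℝ E} {C : ℝ} (hf : ∀ x, f x ≤ C * ‖x‖) (x y : E) :
    |f x - f y| ≤ C * ‖x - y‖ :=
  (abs_sub_map_le_sub f x y).trans (hf _)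

variable [MeasurableSpace E]

lemma exists_sum_map_eq_integral_comp_simpleFunc {μ : Measure E} (s : SimpleFunc E E)
    (hs : Integrable s μ) :
    ∃ (n : ℕ) (v : Fin n → E), ∀ f : Seminorm ℝ E, Integrable (fun x ↦ f (s x)) μ →
      ∑ i, f (v i) = ∫ x, f (s x) ∂μ := by
  let t := s.range.equivFin.symm
  refine ⟨s.range.card, fun i ↦ μ.real (s ⁻¹' {(t i : E)}) • (t i : E), fun f hf ↦ ?_⟩
  calc
    _ = ∑ i, μ.real (s ⁻¹' {(t i : E)}) * f (t i) := by
      simp only [map_smul_eq_mul, Real.norm_of_nonneg measureReal_nonneg]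
    _ = ∑ y ∈ s.range, μ.real (s ⁻¹' {y}) * f y := by
      rw [Equiv.sum_comp t fun y : s.range ↦ μ.real (s ⁻¹' {(y : E)}) * f y,
        Finset.sum_coe_sort s.range fun y ↦ μ.real (s ⁻¹' {y}) * f y]
    _ = (s.map f).integral μ := (SimpleFunc.map_integral s f hs (map_zero f)).symm
    _ = ∫ x, f (s x) ∂μ := SimpleFunc.integral_eq_integral (s.map f) hf

lemma exists_abs_sum_seminorm_sub_integral_le {μ : Measure E} (hμ : Integrable id μ) {ε : ℝ}
    (hε : 0 < ε) :
    ∃ (n : ℕ) (v : Fin n → E), ∀ (f : Seminorm ℝ E) (C : NNReal), (∀ x, f x ≤ C * ‖x‖) →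
      |∑ i, f (v i) - ∫ x, f x ∂μ| ≤ C * ε := by
  obtain ⟨s, hs_lt, hs_mem⟩ := (memLp_one_iff_integrable.2 hμ).exists_simpleFunc_eLpNorm_sub_lt
    ENNReal.one_ne_top (ENNReal.ofReal_pos.2 hε).ne'
  have hs : Integrable s μ := memLp_one_iff_integrable.1 hs_mem
  have hdiff : Integrable (fun x ↦ s x - x) μ := hs.sub hμ
  have hdiff_le : ∫ x, ‖s x - x‖ ∂μ ≤ ε := by
    rw [integral_norm_eq_lintegral_enorm hdiff.1]
    refine ENNReal.toReal_le_of_le_ofReal hε.le ?_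
    rw [eLpNorm_sub_comm, eLpNorm_one_eq_lintegral_enorm] at hs_lt
    exact hs_lt.le
  obtain ⟨n, v, hv⟩ := exists_sum_map_eq_integral_comp_simpleFunc s hs
  refine ⟨n, v, fun f C hf ↦ ?_⟩
  have hcont : Continuous f := (LipschitzWith.of_dist_le_mul (K := C) fun x y ↦ by
    rw [Real.dist_eq, dist_eq_norm]
    exact abs_seminorm_sub_le hf x y).continuous
  have hint {g : E → E} (hg : Integrable g μ) : Integrable (fun x ↦ f (g x)) μ :=
    (hg.norm.const_mul C).mono' (hcont.comp_aestronglyMeasurable hg.1) <| .of_forall fun x ↦ by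
      simpa only [Real.norm_of_nonneg (apply_nonneg f _)] using hf (g x)
  have hint_id : Integrable f μ := hint hμ
  rw [hv f (hint hs), ← integral_sub (hint hs) hint_id]
  calc
    _ ≤ ∫ x, |f (s x) - f x| ∂μ := abs_integral_le_integral_abs
    _ ≤ ∫ x, C * ‖s x - x‖ ∂μ :=
      integral_mono ((hint hs).sub hint_id).abs (hdiff.norm.const_mul _) fun x ↦
        abs_seminorm_sub_le hf (s x) x
    _ ≤ C * ε := by
      rw [integral_const_mul]
      gcongr

end Discretization

section ColumnMatrix

variable {𝕜 : Type*} [RCLike 𝕜] {d p : ℕ}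

lemma real_inner_eq_re_inner_euclideanSpace (x y : EuclideanSpace 𝕜 (Fin d)) :
    inner ℝ x y = RCLike.re (inner 𝕜 x y) := by
  simp only [PiLp.inner_apply, map_sum]
  rfl

variable (𝕜 d) in
lemma finrank_real_euclideanSpace :
    Module.finrank ℝ (EuclideanSpace 𝕜 (Fin d)) = Module.finrank ℝ 𝕜 * d := by
  rw [← Module.finrank_mul_finrank ℝ 𝕜, finrank_euclideanSpace_fin]

variable (𝕜 d p) in
/-- The `d × p` matrices over `𝕜` with the Frobenius norm, encoded by their `p` columns, so that the
standard Gaussian on this space has independent standard Gaussian columns. -/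
abbrev ColumnMatrix : Type _ := PiLp 2 fun _ : Fin p ↦ EuclideanSpace 𝕜 (Fin d)

namespace ColumnMatrix

/-- The linear map `x ↦ G x` of a matrix `G`. -/
noncomputable def toCLM (G : ColumnMatrix 𝕜 d p) :
    EuclideanSpace 𝕜 (Fin p) →L[𝕜] EuclideanSpace 𝕜 (Fin d) :=
  ∑ k, (EuclideanSpace.proj k).smulRight (G k)

lemma toCLM_apply (G : ColumnMatrix 𝕜 d p) (x : EuclideanSpace 𝕜 (Fin p)) :
    G.toCLM x = ∑ k, x k • G k := by
  simp [toCLM]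

/-- The rank-one matrix `t x*`. -/
noncomputable def rankOne (x : EuclideanSpace 𝕜 (Fin p)) (t : EuclideanSpace 𝕜 (Fin d)) :
    ColumnMatrix 𝕜 d p :=
  WithLp.toLp 2 fun k ↦ (starRingEnd 𝕜) (x k) • t

/-- Evaluation `G ↦ G x` at a fixed vector, over `ℝ` because the Gaussian measure lives on the
underlying real inner product space. -/
noncomputable def evalCLM (x : EuclideanSpace 𝕜 (Fin p)) :
    ColumnMatrix 𝕜 d p →L[ℝ] EuclideanSpace 𝕜 (Fin d) :=
  (∑ k, x k • PiLp.proj 2 (fun _ : Fin p ↦ EuclideanSpace 𝕜 (Fin d)) k :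
    ColumnMatrix 𝕜 d p →L[𝕜] EuclideanSpace 𝕜 (Fin d)).restrictScalars ℝ

@[simp]
lemma evalCLM_apply (x : EuclideanSpace 𝕜 (Fin p)) (G : ColumnMatrix 𝕜 d p) :
    evalCLM x G = G.toCLM x := by
  simp [evalCLM, toCLM_apply]

lemma inner_rankOne_left (x : EuclideanSpace 𝕜 (Fin p)) (t : EuclideanSpace 𝕜 (Fin d))
    (G : ColumnMatrix 𝕜 d p) : inner 𝕜 (rankOne x t) G = inner 𝕜 t (G.toCLM x) := by
  rw [PiLp.inner_apply, toCLM_apply, inner_sum]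
  simp [rankOne, inner_smul_left, inner_smul_right]

lemma toCLM_rankOne (x y : EuclideanSpace 𝕜 (Fin p)) (t : EuclideanSpace 𝕜 (Fin d)) :
    (rankOne x t).toCLM y = inner 𝕜 x y • t := by
  simp [toCLM_apply, rankOne, smul_smul, PiLp.inner_apply, Finset.sum_smul]

lemma inner_rankOne_rankOne (x y : EuclideanSpace 𝕜 (Fin p)) (s t : EuclideanSpace 𝕜 (Fin d)) :
    inner 𝕜 (rankOne x s) (rankOne y t) = inner 𝕜 y x * inner 𝕜 s t := by
  rw [inner_rankOne_left, toCLM_rankOne, inner_smul_right]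

lemma norm_rankOne (x : EuclideanSpace 𝕜 (Fin p)) (t : EuclideanSpace 𝕜 (Fin d)) :
    ‖rankOne x t‖ = ‖x‖ * ‖t‖ := by
  rw [← sq_eq_sq₀ (by positivity) (by positivity), mul_pow,
    @norm_sq_eq_re_inner 𝕜, inner_rankOne_rankOne, inner_self_eq_norm_sq_to_K,
    inner_self_eq_norm_sq_to_K]
  norm_cast

/-- For a unit vector `x`, the isometry `t ↦ t x*`; it is the adjoint of `evalCLM x`. -/
noncomputable def rankOneIsometry {x : EuclideanSpace 𝕜 (Fin p)} (hx : ‖x‖ = 1) :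
    EuclideanSpace 𝕜 (Fin d) →ₗᵢ[ℝ] ColumnMatrix 𝕜 d p where
  toFun := rankOne x
  map_add' s t := by ext; simp [rankOne]
  map_smul' r t := by ext; simp [rankOne]
  norm_map' t := (norm_rankOne x t).trans (by rw [hx, one_mul])

lemma real_inner_evalCLM {x : EuclideanSpace 𝕜 (Fin p)} (hx : ‖x‖ = 1) (G : ColumnMatrix 𝕜 d p)
    (t : EuclideanSpace 𝕜 (Fin d)) :
    inner ℝ (evalCLM x G) t = inner ℝ G (rankOneIsometry hx t) := by
  rw [evalCLM_apply, real_inner_comm, real_inner_eq_re_inner_euclideanSpace, ← inner_rankOne_left,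
    real_inner_comm, PiLp.inner_apply, PiLp.inner_apply, map_sum]
  simp only [real_inner_eq_re_inner_euclideanSpace]
  rfl

lemma norm_sq_eq_sum (G : ColumnMatrix 𝕜 d p) : ‖G‖ ^ 2 = ∑ k, ‖G k‖ ^ 2 :=
  PiLp.norm_sq_eq_of_L2 _ G

variable {x : EuclideanSpace 𝕜 (Fin p)} {φ : EuclideanSpace 𝕜 (Fin d) → EuclideanSpace 𝕜 (Fin d)}

lemma integral_inner_toCLM (hx : ‖x‖ = 1) (y : EuclideanSpace 𝕜 (Fin p))
    (hφ : MemLp φ 2 (stdGaussian _)) :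
    ∫ G : ColumnMatrix 𝕜 d p, inner 𝕜 (φ (G.toCLM x)) (G.toCLM y) ∂stdGaussian _ =
      (∫ h, inner 𝕜 (φ h) h ∂stdGaussian _) * inner 𝕜 x y := by
  have h := integral_inner_comp_eq_of_adjoint_isometry (𝕜 := 𝕜) (real_inner_evalCLM hx)
    (evalCLM y) hφ
  simp only [evalCLM_apply] at h
  rw [h, ← integral_mul_const]
  refine integral_congr_ae (.of_forall fun t ↦ ?_)
  change inner 𝕜 (φ t) ((rankOne x t).toCLM y) = _
  rw [toCLM_rankOne, inner_smul_right, mul_comm]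

lemma integrable_inner_toCLM (hx : ‖x‖ = 1) (y : EuclideanSpace 𝕜 (Fin p))
    (hφ : MemLp φ 2 (stdGaussian _)) :
    Integrable (fun G : ColumnMatrix 𝕜 d p ↦ inner 𝕜 (φ (G.toCLM x)) (G.toCLM y))
      (stdGaussian _) := by
  have hmap := stdGaussian_map_of_adjoint_isometry (real_inner_evalCLM (d := d) hx)
  simp only [← evalCLM_apply]
  exact integrable_inner_of_memLp_two ((hmap ▸ hφ).comp_of_map (by fun_prop))
    ((evalCLM y).comp_memLp' IsGaussian.memLp_two_id)

end ColumnMatrix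

end ColumnMatrix

section GramForm

variable {𝕜 V ι : Type*} [RCLike 𝕜] [NormedAddCommGroup V] [InnerProductSpace 𝕜 V] [Fintype ι]

/-- The sesquilinear form `∑ i, ∑ j, A i j * ⟨u i, v j⟩` of a matrix `A` on families of vectors; its
diagonal values at families of unit vectors are what `gammaSeminorm` maximizes. -/
noncomputable def gramForm (A : Matrix ι ι 𝕜) (u v : ι → V) : 𝕜 :=
  ∑ i, ∑ j, A i j * inner 𝕜 (u i) (v j)

lemma gramForm_sub_left (A : Matrix ι ι 𝕜) (u u' v : ι → V) :
    gramForm A (u - u') v = gramForm A u v - gramForm A u' v := by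
  simp only [gramForm, Pi.sub_apply, inner_sub_left, mul_sub, Finset.sum_sub_distrib]

lemma gramForm_sub_right (A : Matrix ι ι 𝕜) (u v v' : ι → V) :
    gramForm A u (v - v') = gramForm A u v - gramForm A u v' := by
  simp only [gramForm, Pi.sub_apply, inner_sub_right, mul_sub, Finset.sum_sub_distrib]

lemma gramForm_smul_left (A : Matrix ι ι 𝕜) (c : 𝕜) (u v : ι → V) :
    gramForm A (c • u) v = starRingEnd 𝕜 c * gramForm A u v := by
  simp only [gramForm, Pi.smul_apply, inner_smul_left, Finset.mul_sum, mul_left_comm]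

lemma gramForm_smul_right (A : Matrix ι ι 𝕜) (c : 𝕜) (u v : ι → V) :
    gramForm A u (c • v) = c * gramForm A u v := by
  simp only [gramForm, Pi.smul_apply, inner_smul_right, Finset.mul_sum, mul_left_comm]

lemma conj_gramForm {A : Matrix ι ι 𝕜} (hA : A.IsHermitian) (u v : ι → V) :
    starRingEnd 𝕜 (gramForm A u v) = gramForm A v u := by
  simp only [gramForm, map_sum, map_mul, inner_conj_symm, ← RCLike.star_def, hA.apply]
  exact Finset.sum_comm

open scoped ComplexOrder Matrix in
lemma gramForm_self_nonneg {A : Matrix ι ι 𝕜} (hA : A.PosSemidef) (v : ι → V) :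
    0 ≤ gramForm A v v := by
  have h := (hA.hadamard (Matrix.posSemidef_gram 𝕜 v)).dotProduct_mulVec_nonneg 1
  simpa [gramForm, dotProduct, Matrix.mulVec] using h

open scoped ComplexOrder in
lemma re_gramForm_self {A : Matrix ι ι 𝕜} (hA : A.PosSemidef) (v : ι → V) :
    RCLike.re (gramForm A v v) = ‖gramForm A v v‖ := by
  rw [← RCLike.ofReal_re (K := 𝕜) ‖_‖, RCLike.norm_of_nonneg' (gramForm_self_nonneg hA v)]

open scoped ComplexOrder in
lemma re_gramForm_sub_le {A : Matrix ι ι 𝕜} (hA : A.PosSemidef) (α : ℝ) (u v : ι → V) :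
    2 * α * RCLike.re (gramForm A u v) - α ^ 2 * RCLike.re (gramForm A v v) ≤
      ‖gramForm A u u‖ := by
  have h := (RCLike.nonneg_iff.1 (gramForm_self_nonneg hA (u - (α : 𝕜) • v))).1
  have hvu : RCLike.re (gramForm A v u) = RCLike.re (gramForm A u v) := by
    rw [← conj_gramForm hA.isHermitian, RCLike.conj_re]
  rw [← re_gramForm_self hA]
  simp only [gramForm_sub_left, gramForm_sub_right, gramForm_smul_left, gramForm_smul_right,
    RCLike.conj_ofReal, map_sub, RCLike.re_ofReal_mul, hvu] at h
  linarith

section Integral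

variable {Ω : Type*} [MeasurableSpace Ω] {μ : Measure Ω} {u v : ι → Ω → V}

lemma integrable_gramForm (A : Matrix ι ι 𝕜)
    (h : ∀ i j, Integrable (fun ω ↦ inner 𝕜 (u i ω) (v j ω)) μ) :
    Integrable (fun ω ↦ gramForm A (u · ω) (v · ω)) μ :=
  integrable_finsetSum _ fun i _ ↦ integrable_finsetSum _ fun j _ ↦ (h i j).const_mul _

lemma integral_gramForm_eq {W : Type*} [NormedAddCommGroup W] [InnerProductSpace 𝕜 W]
    (A : Matrix ι ι 𝕜) {x : ι → W} {c : 𝕜}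
    (h : ∀ i j, Integrable (fun ω ↦ inner 𝕜 (u i ω) (v j ω)) μ)
    (hc : ∀ i j, ∫ ω, inner 𝕜 (u i ω) (v j ω) ∂μ = c * inner 𝕜 (x i) (x j)) :
    ∫ ω, gramForm A (u · ω) (v · ω) ∂μ = c * gramForm A x x := by
  have hA (i j : ι) : Integrable (fun ω ↦ A i j * inner 𝕜 (u i ω) (v j ω)) μ :=
    (h i j).const_mul _
  simp only [gramForm, Finset.mul_sum]
  rw [integral_finsetSum _ fun i _ ↦ integrable_finsetSum _ fun j _ ↦ hA i j]
  refine Finset.sum_congr rfl fun i _ ↦ ?_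
  rw [integral_finsetSum _ fun j _ ↦ hA i j]
  refine Finset.sum_congr rfl fun j _ ↦ ?_
  rw [integral_const_mul, hc, mul_left_comm]

end Integral

end GramForm

section GammaSeminorm

variable {𝕜 : Type*} [RCLike 𝕜] {n d p : ℕ}

lemma norm_gramForm_le_gammaSeminorm (A : Matrix (Fin n) (Fin n) 𝕜)
    {x : Fin n → EuclideanSpace 𝕜 (Fin d)} (hx : ∀ i, ‖x i‖ = 1) :
    ‖gramForm A x x‖ ≤ gammaSeminorm d A := by
  refine le_csSup ⟨∑ i, ∑ j, ‖A i j‖, ?_⟩ ⟨x, hx, rfl⟩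
  rintro _ ⟨y, hy, rfl⟩
  refine norm_sum_le_of_le _ fun i _ ↦ norm_sum_le_of_le _ fun j _ ↦ ?_
  rw [norm_mul]
  refine mul_le_of_le_one_right (norm_nonneg _) ((norm_inner_le_norm _ _).trans ?_)
  rw [hy, hy, one_mul]

lemma gammaSeminorm_nonneg (A : Matrix (Fin n) (Fin n) 𝕜) : 0 ≤ gammaSeminorm d A := by
  refine Real.sSup_nonneg ?_
  rintro _ ⟨x, _, rfl⟩
  exact norm_nonneg _

lemma gammaSeminorm_le {A : Matrix (Fin n) (Fin n) 𝕜} {B : ℝ} (hB : 0 ≤ B)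
    (h : ∀ x : Fin n → EuclideanSpace 𝕜 (Fin d), (∀ i, ‖x i‖ = 1) → ‖gramForm A x x‖ ≤ B) :
    gammaSeminorm d A ≤ B := by
  refine Real.sSup_le ?_ hB
  rintro _ ⟨x, hx, rfl⟩
  exact h x hx

end GammaSeminorm

section UnitNormalize

variable {𝕜 V : Type*} [RCLike 𝕜] [NormedAddCommGroup V] [InnerProductSpace 𝕜 V]

variable (𝕜) in
open Classical in
/-- The unit vector in the direction of `v`, with the prescribed value `e` at `v = 0` (where
`NormedSpace.normalize` is `0`), so that it always has norm one if `e` does. -/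
noncomputable def unitNormalize (e v : V) : V :=
  if v = 0 then e else (‖v‖⁻¹ : 𝕜) • v

lemma norm_unitNormalize {e : V} (he : ‖e‖ = 1) (v : V) : ‖unitNormalize 𝕜 e v‖ = 1 := by
  unfold unitNormalize
  split_ifs with hv
  · exact he
  · rw [norm_smul, norm_inv, RCLike.norm_ofReal, abs_norm, inv_mul_cancel₀ (norm_ne_zero_iff.2 hv)]

lemma inner_unitNormalize_left (e v : V) : inner 𝕜 (unitNormalize 𝕜 e v) v = (‖v‖ : 𝕜) := by
  unfold unitNormalize
  split_ifs with hv
  · rw [hv, inner_zero_right, norm_zero, RCLike.ofReal_zero]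
  · have hv_norm : (‖v‖ : 𝕜) ≠ 0 := by simpa using hv
    rw [inner_smul_left, inner_self_eq_norm_sq_to_K, map_inv₀, RCLike.conj_ofReal, sq,
      inv_mul_cancel_left₀ hv_norm]

lemma measurable_unitNormalize [MeasurableSpace V] [BorelSpace V] [SecondCountableTopology V]
    (e : V) : Measurable (unitNormalize 𝕜 e) := by
  refine .ite (measurableSet_singleton 0) measurable_const ?_
  have : Measurable fun v : V ↦ (‖v‖⁻¹ : 𝕜) :=
    (RCLike.measurable_ofReal.comp measurable_norm).inv
  exact this.smul measurable_id

end UnitNormalize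

section UpperBound

variable {𝕜 : Type*} [RCLike 𝕜] {n d p : ℕ}

lemma memLp_unitNormalize_stdGaussian {e : EuclideanSpace 𝕜 (Fin d)} (he : ‖e‖ = 1) :
    MemLp (unitNormalize 𝕜 e) 2 (stdGaussian (EuclideanSpace 𝕜 (Fin d))) :=
  .of_bound (measurable_unitNormalize e).aestronglyMeasurable 1 <| .of_forall fun v ↦
    (norm_unitNormalize he v).le

lemma integral_inner_unitNormalize_stdGaussian [NeZero d] (e : EuclideanSpace 𝕜 (Fin d)) :
    ∫ h, inner 𝕜 (unitNormalize 𝕜 e h) h ∂stdGaussian (EuclideanSpace 𝕜 (Fin d)) =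
      (gaussMeanNorm (Module.finrank ℝ 𝕜 * d) : 𝕜) := by
  simp only [inner_unitNormalize_left]
  rw [integral_ofReal, integral_norm_stdGaussian, finrank_real_euclideanSpace]

variable (𝕜 d) in
lemma integral_inner_self_stdGaussian [NeZero d] :
    ∫ h, inner 𝕜 h h ∂stdGaussian (EuclideanSpace 𝕜 (Fin d)) =
      (((Module.finrank ℝ 𝕜 * d : ℕ) : ℝ) : 𝕜) := by
  simp only [inner_self_eq_norm_sq_to_K, ← RCLike.ofReal_pow]
  rw [integral_ofReal, integral_norm_sq_stdGaussian, finrank_real_euclideanSpace]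

section

open ColumnMatrix

variable {φ : EuclideanSpace 𝕜 (Fin d) → EuclideanSpace 𝕜 (Fin d)}
  {x : Fin n → EuclideanSpace 𝕜 (Fin p)}

lemma integrable_re_gramForm_toCLM (A : Matrix (Fin n) (Fin n) 𝕜) (hx : ∀ i, ‖x i‖ = 1)
    (hφ : MemLp φ 2 (stdGaussian _)) :
    Integrable (fun G : ColumnMatrix 𝕜 d p ↦ RCLike.re
      (gramForm A (fun i ↦ φ (G.toCLM (x i))) fun i ↦ G.toCLM (x i))) (stdGaussian _) :=
  (integrable_gramForm A fun i j ↦ integrable_inner_toCLM (hx i) (x j) hφ).re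

open scoped ComplexOrder in
lemma integral_re_gramForm_toCLM {A : Matrix (Fin n) (Fin n) 𝕜} (hA : A.PosSemidef)
    (hx : ∀ i, ‖x i‖ = 1) (hφ : MemLp φ 2 (stdGaussian _)) {c : ℝ}
    (hc : ∫ h, inner 𝕜 (φ h) h ∂stdGaussian _ = (c : 𝕜)) :
    ∫ G : ColumnMatrix 𝕜 d p, RCLike.re
        (gramForm A (fun i ↦ φ (G.toCLM (x i))) fun i ↦ G.toCLM (x i)) ∂stdGaussian _ =
      c * ‖gramForm A x x‖ := by
  have hint (i j : Fin n) := integrable_inner_toCLM (hx i) (x j) hφ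
  rw [integral_re (integrable_gramForm A hint), integral_gramForm_eq A hint fun i j ↦
    (integral_inner_toCLM (hx i) (x j) hφ).trans (by rw [hc]), RCLike.re_ofReal_mul,
    re_gramForm_self hA]

end

lemma gaussRatio_mul_norm_gramForm_le [NeZero d] {A : Matrix (Fin n) (Fin n) 𝕜}
    (hA : A ∈ psdCones 𝕜 n) {x : Fin n → EuclideanSpace 𝕜 (Fin p)} (hx : ∀ i, ‖x i‖ = 1) :
    gaussRatio (Module.finrank ℝ 𝕜 * d) * ‖gramForm A x x‖ ≤ gammaSeminorm d A := by
  obtain ⟨e, he⟩ := exists_norm_eq (EuclideanSpace 𝕜 (Fin d)) zero_le_one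
  have hN : ((Module.finrank ℝ 𝕜 * d : ℕ) : ℝ) ≠ 0 :=
    Nat.cast_ne_zero.2 (mul_ne_zero Module.finrank_pos.ne' (NeZero.ne d))
  set N := Module.finrank ℝ 𝕜 * d
  set α := gaussMeanNorm N / N with hα
  have hu := memLp_unitNormalize_stdGaussian he
  have hv : MemLp (fun h ↦ h) 2 (stdGaussian (EuclideanSpace 𝕜 (Fin d))) :=
    IsGaussian.memLp_two_id
  have hu_int := (integrable_re_gramForm_toCLM (p := p) A hx hu).const_mul (2 * α)
  have hv_int := (integrable_re_gramForm_toCLM (p := p) A hx hv).const_mul (α ^ 2)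
  calc
    gaussRatio N * ‖gramForm A x x‖
        = 2 * α * (gaussMeanNorm N * ‖gramForm A x x‖) - α ^ 2 * (N * ‖gramForm A x x‖) := by
      rw [gaussRatio, hα]
      field_simp
      ring
    _ = ∫ G : ColumnMatrix 𝕜 d p, (2 * α * RCLike.re
            (gramForm A (fun i ↦ unitNormalize 𝕜 e (G.toCLM (x i))) fun i ↦ G.toCLM (x i)) -
          α ^ 2 * RCLike.re (gramForm A (fun i ↦ G.toCLM (x i)) fun i ↦ G.toCLM (x i)))
          ∂stdGaussian _ := by
      rw [integral_sub hu_int hv_int, integral_const_mul, integral_const_mul,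
        integral_re_gramForm_toCLM hA hx hu (integral_inner_unitNormalize_stdGaussian e),
        integral_re_gramForm_toCLM hA hx hv (integral_inner_self_stdGaussian 𝕜 d)]
    _ ≤ ∫ _ : ColumnMatrix 𝕜 d p, gammaSeminorm d A ∂stdGaussian _ :=
      integral_mono (hu_int.sub hv_int) (integrable_const _) fun G ↦
        (re_gramForm_sub_le hA α _ _).trans
          (norm_gramForm_le_gammaSeminorm A fun i ↦ norm_unitNormalize he _)
    _ = gammaSeminorm d A := by
      rw [integral_const, probReal_univ, one_smul]

lemma gammaSeminorm_le_of_mem_psdCones [NeZero d] {A : Matrix (Fin n) (Fin n) 𝕜}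
    (hA : A ∈ psdCones 𝕜 n) :
    gammaSeminorm p A ≤ (gaussRatio (Module.finrank ℝ 𝕜 * d))⁻¹ * gammaSeminorm d A := by
  have hρ : 0 < gaussRatio (Module.finrank ℝ 𝕜 * d) :=
    gaussRatio_pos (Nat.mul_pos Module.finrank_pos (NeZero.pos d))
  refine gammaSeminorm_le (mul_nonneg (inv_nonneg.2 hρ.le) (gammaSeminorm_nonneg A)) fun x hx ↦ ?_
  rw [inv_mul_eq_div, le_div_iff₀' hρ]
  exact gaussRatio_mul_norm_gramForm_le hA hx

variable (𝕜 d p) in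
lemma conicConst_le [NeZero d] :
    conicConst (psdCones 𝕜) d p ≤ ENNReal.ofReal (gaussRatio (Module.finrank ℝ 𝕜 * d))⁻¹ := by
  have hρ : 0 < gaussRatio (Module.finrank ℝ 𝕜 * d) :=
    gaussRatio_pos (Nat.mul_pos Module.finrank_pos (NeZero.pos d))
  refine iSup_le fun n ↦ iSup₂_le fun A hA ↦ ENNReal.div_le_of_le_mul ?_
  rw [← ENNReal.ofReal_mul (inv_nonneg.2 hρ.le)]
  exact ENNReal.ofReal_le_ofReal (gammaSeminorm_le_of_mem_psdCones hA)

end UpperBound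

section LowerBound

variable {𝕜 : Type*} [RCLike 𝕜] {n d p : ℕ}

lemma integral_norm_sq_inner_stdGaussian (m : EuclideanSpace 𝕜 (Fin p)) :
    ∫ g, ‖inner 𝕜 m g‖ ^ 2 ∂stdGaussian (EuclideanSpace 𝕜 (Fin p)) =
      Module.finrank ℝ 𝕜 * ‖m‖ ^ 2 := by
  rcases eq_or_ne m 0 with rfl | hm
  · simp
  set u := NormedSpace.normalize m
  have hu : ‖u‖ = 1 := NormedSpace.norm_normalize hm
  have hmu : m = (‖m‖ : 𝕜) • u := by
    rw [← RCLike.real_smul_eq_coe_smul, NormedSpace.norm_smul_normalize]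
  let ι : 𝕜 →ₗᵢ[ℝ] EuclideanSpace 𝕜 (Fin p) :=
    { toFun := fun c ↦ c • u
      map_add' := fun c c' ↦ add_smul c c' u
      map_smul' := fun r c ↦ smul_assoc r c u
      norm_map' := fun c ↦ (norm_smul c u).trans (by rw [hu, mul_one]) }
  have hmap : (stdGaussian _).map (fun g ↦ inner 𝕜 u g) = stdGaussian 𝕜 :=
    stdGaussian_map_of_adjoint_isometry (P := (innerSL 𝕜 u).restrictScalars ℝ) (ι := ι)
      fun g c ↦ by
        change _ = inner ℝ g (c • u)
        rw [real_inner_eq_re_inner_euclideanSpace, inner_smul_right, ← inner_conj_symm g u]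
        rfl
  calc
    _ = ∫ g, ‖m‖ ^ 2 * ‖inner 𝕜 u g‖ ^ 2 ∂stdGaussian (EuclideanSpace 𝕜 (Fin p)) := by
      refine integral_congr_ae (.of_forall fun g ↦ ?_)
      dsimp only
      conv_lhs => rw [hmu, inner_smul_left, norm_mul, RCLike.norm_conj, RCLike.norm_ofReal,
        abs_norm, mul_pow]
    _ = ‖m‖ ^ 2 * ∫ c : 𝕜, ‖c‖ ^ 2 ∂stdGaussian 𝕜 := by
      rw [integral_const_mul, ← hmap, integral_map (by fun_prop) (by fun_prop)]
    _ = _ := by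
      rw [integral_norm_sq_stdGaussian, mul_comm]

namespace ColumnMatrix

lemma norm_toCLM_apply_le (G : ColumnMatrix 𝕜 d p) (v : EuclideanSpace 𝕜 (Fin p)) :
    ‖G.toCLM v‖ ≤ ‖G‖ * ‖v‖ := by
  rcases (norm_nonneg (G.toCLM v)).eq_or_lt with h0 | h0
  · rw [← h0]
    positivity
  refine le_of_mul_le_mul_right ?_ h0
  calc
    ‖G.toCLM v‖ * ‖G.toCLM v‖ = ‖inner 𝕜 (rankOne v (G.toCLM v)) G‖ := by
      rw [inner_rankOne_left, ← inner_self_re_eq_norm, inner_self_eq_norm_mul_norm]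
    _ ≤ ‖v‖ * ‖G.toCLM v‖ * ‖G‖ := (norm_inner_le_norm _ _).trans (by rw [norm_rankOne])
    _ = ‖G‖ * ‖v‖ * ‖G.toCLM v‖ := by ring

lemma integral_norm_sq_toCLM_stdGaussian (G : ColumnMatrix 𝕜 d p) :
    ∫ g, ‖G.toCLM g‖ ^ 2 ∂stdGaussian (EuclideanSpace 𝕜 (Fin p)) =
      Module.finrank ℝ 𝕜 * ‖G‖ ^ 2 := by
  let row (l : Fin d) : EuclideanSpace 𝕜 (Fin p) :=
    WithLp.toLp 2 fun k ↦ starRingEnd 𝕜 (G k l)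
  have hrow (g : EuclideanSpace 𝕜 (Fin p)) (l : Fin d) : G.toCLM g l = inner 𝕜 (row l) g := by
    simp [toCLM_apply, row, PiLp.inner_apply]
  have hint (l : Fin d) : Integrable (fun g ↦ ‖inner 𝕜 (row l) g‖ ^ 2)
      (stdGaussian (EuclideanSpace 𝕜 (Fin p))) :=
    (((innerSL 𝕜 (row l)).restrictScalars ℝ).comp_memLp'
      IsGaussian.memLp_two_id).integrable_norm_pow two_ne_zero
  simp only [EuclideanSpace.norm_sq_eq, hrow, norm_sq_eq_sum]
  rw [integral_finsetSum _ fun l _ ↦ hint l, Finset.sum_comm, Finset.mul_sum]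
  refine Finset.sum_congr rfl fun l _ ↦ ?_
  rw [integral_norm_sq_inner_stdGaussian, EuclideanSpace.norm_sq_eq]
  simp only [row, RCLike.norm_conj]

lemma integral_norm_toCLM_stdGaussian_le (G : ColumnMatrix 𝕜 d p) :
    ∫ g, ‖G.toCLM g‖ ∂stdGaussian (EuclideanSpace 𝕜 (Fin p)) ≤
      √(Module.finrank ℝ 𝕜 * gaussRatio (Module.finrank ℝ 𝕜 * d)) * ‖G‖ := by
  have h := sq_integral_norm_clm_le (G.toCLM.restrictScalars ℝ)
  simp only [ContinuousLinearMap.coe_restrictScalars', integral_norm_sq_toCLM_stdGaussian,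
    finrank_real_euclideanSpace] at h
  refine (Real.le_sqrt_of_sq_le h).trans_eq ?_
  rw [← mul_assoc, mul_comm (gaussRatio _), Real.sqrt_mul' _ (sq_nonneg _),
    Real.sqrt_sq (norm_nonneg _)]

variable (v : Fin n → EuclideanSpace 𝕜 (Fin p)) (x : Fin n → EuclideanSpace 𝕜 (Fin d))

lemma inner_sum_rankOne_left (G : ColumnMatrix 𝕜 d p) :
    inner 𝕜 (∑ i, rankOne (v i) (x i)) G = ∑ i, inner 𝕜 (x i) (G.toCLM (v i)) := by
  simp only [sum_inner, inner_rankOne_left]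

lemma norm_gramForm_transpose_gram :
    ‖gramForm (Matrix.gram 𝕜 v).transpose x x‖ = ‖∑ i, rankOne (v i) (x i)‖ ^ 2 := by
  have h : gramForm (Matrix.gram 𝕜 v).transpose x x =
      inner 𝕜 (∑ i, rankOne (v i) (x i)) (∑ i, rankOne (v i) (x i)) := by
    simp only [gramForm, Matrix.transpose_apply, Matrix.gram_apply, sum_inner, inner_sum,
      inner_rankOne_rankOne]
    exact Finset.sum_comm
  rw [h, ← inner_self_re_eq_norm, inner_self_eq_norm_sq]

variable {x} in
lemma norm_sum_rankOne_sq_le (hx : ∀ i, ‖x i‖ = 1) :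
    ‖∑ i, rankOne (v i) (x i)‖ ^ 2 ≤ ∑ i, ‖(∑ i, rankOne (v i) (x i)).toCLM (v i)‖ := by
  rw [← inner_self_eq_norm_sq (𝕜 := 𝕜), inner_sum_rankOne_left, map_sum]
  gcongr with i
  exact (RCLike.re_le_norm _).trans ((norm_inner_le_norm _ _).trans (by rw [hx, one_mul]))

variable (𝕜 p) in
lemma exists_toCLM_eq_self : ∃ I : ColumnMatrix 𝕜 p p, ‖I‖ = √p ∧ ∀ w, I.toCLM w = w := by
  refine ⟨WithLp.toLp 2 fun k ↦ EuclideanSpace.single k 1, ?_, fun w ↦ ?_⟩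
  · rw [PiLp.norm_eq_of_L2]
    simp
  · ext l
    simp [toCLM_apply, Pi.single_apply]

lemma sum_norm_le_sqrt_mul_norm_sum_rankOne (e : EuclideanSpace 𝕜 (Fin p)) :
    ∑ i, ‖v i‖ ≤ √p * ‖∑ i, rankOne (v i) (unitNormalize 𝕜 e (v i))‖ := by
  obtain ⟨I, hI_norm, hI⟩ := exists_toCLM_eq_self 𝕜 p
  have h : inner 𝕜 (∑ i, rankOne (v i) (unitNormalize 𝕜 e (v i))) I =
      ((∑ i, ‖v i‖ : ℝ) : 𝕜) := by
    rw [inner_sum_rankOne_left, RCLike.ofReal_sum]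
    simp only [hI, inner_unitNormalize_left]
  calc
    ∑ i, ‖v i‖ = ‖inner 𝕜 (∑ i, rankOne (v i) (unitNormalize 𝕜 e (v i))) I‖ := by
      rw [h, RCLike.norm_ofReal, abs_of_nonneg (Finset.sum_nonneg fun i _ ↦ norm_nonneg _)]
    _ ≤ ‖∑ i, rankOne (v i) (unitNormalize 𝕜 e (v i))‖ * ‖I‖ := norm_inner_le_norm _ _
    _ = _ := by rw [hI_norm, mul_comm]

end ColumnMatrix

open scoped ComplexOrder in
variable (𝕜 d p) in
lemma exists_psd_gammaSeminorm_bounds [NeZero p] {ε : ℝ} (hε : 0 < ε)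
    (hεμ : ε < gaussMeanNorm (Module.finrank ℝ 𝕜 * p)) :
    ∃ n, ∃ A ∈ psdCones 𝕜 n,
      (gaussMeanNorm (Module.finrank ℝ 𝕜 * p) - ε) ^ 2 / p ≤ gammaSeminorm p A ∧
      gammaSeminorm d A ≤
        (√(Module.finrank ℝ 𝕜 * gaussRatio (Module.finrank ℝ 𝕜 * d)) + ε) ^ 2 := by
  obtain ⟨n, v, hv⟩ := exists_abs_sum_seminorm_sub_integral_le
    (IsGaussian.integrable_id (μ := stdGaussian (EuclideanSpace 𝕜 (Fin p)))) hε
  refine ⟨n, (Matrix.gram 𝕜 v).transpose, (Matrix.posSemidef_gram 𝕜 v).transpose, ?_,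
    gammaSeminorm_le (sq_nonneg _) fun x hx ↦ ?_⟩
  · obtain ⟨e, he⟩ := exists_norm_eq (EuclideanSpace 𝕜 (Fin p)) zero_le_one
    refine le_trans ?_ (norm_gramForm_le_gammaSeminorm _ fun i ↦
      norm_unitNormalize (𝕜 := 𝕜) he (v i))
    have h_mean := hv (normSeminorm ℝ _) 1 fun x ↦ by simp
    simp only [coe_normSeminorm, integral_norm_stdGaussian, finrank_real_euclideanSpace,
      NNReal.coe_one, one_mul] at h_mean
    rw [ColumnMatrix.norm_gramForm_transpose_gram, div_le_iff₀' (by exact_mod_cast NeZero.pos p),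
      ← Real.sq_sqrt (Nat.cast_nonneg p), ← mul_pow]
    refine pow_le_pow_left₀ (sub_nonneg.2 hεμ.le) ?_ 2
    linarith [(abs_le.1 h_mean).1, ColumnMatrix.sum_norm_le_sqrt_mul_norm_sum_rankOne v e]
  · rw [ColumnMatrix.norm_gramForm_transpose_gram]
    have h_sq := ColumnMatrix.norm_sum_rankOne_sq_le v hx
    set M := ∑ i, ColumnMatrix.rankOne (v i) (x i)
    have h_mean := hv ((normSeminorm ℝ _).comp (M.toCLM.restrictScalars ℝ).toLinearMap) ‖M‖₊
      M.norm_toCLM_apply_le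
    simp only [Seminorm.comp_apply, coe_normSeminorm, ContinuousLinearMap.coe_coe,
      ContinuousLinearMap.coe_restrictScalars', coe_nnnorm] at h_mean
    have h_le := M.integral_norm_toCLM_stdGaussian_le
    gcongr
    rcases (norm_nonneg M).eq_or_lt with h0 | h0
    · rw [← h0]
      positivity
    · refine le_of_mul_le_mul_right ?_ h0
      linarith [(abs_le.1 h_mean).2]

variable (𝕜 d p) in
lemma le_conicConst [NeZero d] [NeZero p] :
    ENNReal.ofReal (gaussRatio (Module.finrank ℝ 𝕜 * p) / gaussRatio (Module.finrank ℝ 𝕜 * d)) ≤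
      conicConst (psdCones 𝕜) d p := by
  have hk : (0 : ℝ) < Module.finrank ℝ 𝕜 := Nat.cast_pos.2 Module.finrank_pos
  have hp : (0 : ℝ) < p := Nat.cast_pos.2 (NeZero.pos p)
  have hμ := gaussMeanNorm_pos (Nat.mul_pos (Module.finrank_pos (R := ℝ) (M := 𝕜)) (NeZero.pos p))
  have hρ := gaussRatio_pos (Nat.mul_pos (Module.finrank_pos (R := ℝ) (M := 𝕜)) (NeZero.pos d))
  set μ := gaussMeanNorm (Module.finrank ℝ 𝕜 * p) with hμ_def
  set c := √(Module.finrank ℝ 𝕜 * gaussRatio (Module.finrank ℝ 𝕜 * d)) with hc_def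
  have hc : 0 < c := by positivity
  have hval : (μ - 0) ^ 2 / p / (c + 0) ^ 2 =
      gaussRatio (Module.finrank ℝ 𝕜 * p) / gaussRatio (Module.finrank ℝ 𝕜 * d) := by
    rw [sub_zero, add_zero, hc_def, Real.sq_sqrt (by positivity), gaussRatio.eq_def (_ * p),
      ← hμ_def]
    push_cast
    field_simp
  have hcont : ContinuousAt (fun ε : ℝ ↦ (μ - ε) ^ 2 / p / (c + ε) ^ 2) 0 :=
    .div (by fun_prop) (by fun_prop) (by positivity)
  rw [← hval]
  refine le_of_tendsto (x := 𝓝[>] 0)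
    (ENNReal.tendsto_ofReal (hcont.tendsto.mono_left nhdsWithin_le_nhds)) ?_
  filter_upwards [Ioo_mem_nhdsGT hμ] with ε ⟨hε, hεμ⟩
  obtain ⟨n, A, hA, hA_p, hA_d⟩ := exists_psd_gammaSeminorm_bounds 𝕜 d p hε hεμ
  calc
    _ = ENNReal.ofReal ((μ - ε) ^ 2 / p) / ENNReal.ofReal ((c + ε) ^ 2) :=
      ENNReal.ofReal_div_of_pos (pow_pos (add_pos hc hε) 2)
    _ ≤ ENNReal.ofReal (gammaSeminorm p A) / ENNReal.ofReal (gammaSeminorm d A) :=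
      ENNReal.div_le_div (ENNReal.ofReal_le_ofReal hA_p) (ENNReal.ofReal_le_ofReal hA_d)
    _ ≤ _ := le_iSup_of_le n (le_iSup₂ (f := fun A (_ : A ∈ psdCones 𝕜 n) ↦
      ENNReal.ofReal (gammaSeminorm p A) / ENNReal.ofReal (gammaSeminorm d A)) A hA)

end LowerBound

section GaussRatio

lemma gaussRatio_le_one (N : ℕ) : gaussRatio N ≤ 1 := by
  rcases N.eq_zero_or_pos with rfl | hN
  · simp [gaussRatio]
  have : NeZero N := ⟨hN.ne'⟩
  have h := variance_nonneg (fun x ↦ ‖x‖) (stdGaussian (EuclideanSpace ℝ (Fin N)))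
  have hL2 : MemLp (fun x ↦ ‖x‖) 2 (stdGaussian (EuclideanSpace ℝ (Fin N))) :=
    IsGaussian.memLp_two_id.norm
  rw [variance_eq_sub hL2, sub_nonneg] at h
  simp only [Pi.pow_apply] at h
  rw [integral_norm_stdGaussian, integral_norm_sq_stdGaussian, finrank_euclideanSpace_fin] at h
  rwa [gaussRatio, div_le_one (by exact_mod_cast hN)]

lemma gaussMeanNorm_mul_gaussMeanNorm_succ {N : ℕ} (hN : 0 < N) :
    gaussMeanNorm N * gaussMeanNorm (N + 1) = N := by
  have hN' : (0 : ℝ) < N / 2 := by positivity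
  have hΓ : Real.Gamma (N / 2) ≠ 0 := (Real.Gamma_pos_of_pos hN').ne'
  have hΓ' : Real.Gamma ((N + 1) / 2) ≠ 0 := (Real.Gamma_pos_of_pos (by positivity)).ne'
  have hΓ_succ : Real.Gamma ((N + 1 + 1) / 2) = N / 2 * Real.Gamma (N / 2) := by
    rw [← Real.Gamma_add_one hN'.ne']
    ring_nf
  rw [gaussMeanNorm, gaussMeanNorm, Nat.cast_add_one, hΓ_succ]
  field_simp
  rw [Real.sq_sqrt zero_le_two]

lemma one_sub_inv_le_gaussRatio {N : ℕ} (hN : 0 < N) :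
    1 - ((N : ℝ) + 1)⁻¹ ≤ gaussRatio N :=
  calc
    1 - ((N : ℝ) + 1)⁻¹ = (gaussMeanNorm N * gaussMeanNorm (N + 1)) ^ 2 / (N * (N + 1)) := by
      rw [gaussMeanNorm_mul_gaussMeanNorm_succ hN]
      field_simp
      ring
    _ = gaussRatio N * gaussRatio (N + 1) := by
      rw [gaussRatio, gaussRatio, mul_pow, mul_div_mul_comm, Nat.cast_add_one]
    _ ≤ gaussRatio N := mul_le_of_le_one_right (gaussRatio_pos hN).le (gaussRatio_le_one _)

lemma tendsto_gaussRatio : Tendsto gaussRatio atTop (𝓝 1) := by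
  have h : Tendsto (fun N : ℕ ↦ 1 - ((N : ℝ) + 1)⁻¹) atTop (𝓝 1) := by
    simpa using tendsto_one_div_add_atTop_nhds_zero_nat.const_sub (1 : ℝ)
  refine tendsto_of_tendsto_of_tendsto_of_le_of_le' h tendsto_const_nhds ?_
    (.of_forall gaussRatio_le_one)
  filter_upwards [eventually_gt_atTop 0] with N hN using one_sub_inv_le_gaussRatio hN

lemma tendsto_conicConst (𝕜 : Type*) [RCLike 𝕜] (d : ℕ) [NeZero d] :
    Tendsto (fun p : ℕ ↦ conicConst (psdCones 𝕜) d p) atTop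
      (𝓝 (ENNReal.ofReal (gaussRatio (Module.finrank ℝ 𝕜 * d))⁻¹)) := by
  have h : Tendsto (fun p : ℕ ↦ ENNReal.ofReal (gaussRatio (Module.finrank ℝ 𝕜 * p) /
      gaussRatio (Module.finrank ℝ 𝕜 * d))) atTop
      (𝓝 (ENNReal.ofReal (1 / gaussRatio (Module.finrank ℝ 𝕜 * d)))) :=
    ENNReal.tendsto_ofReal
      ((tendsto_gaussRatio.comp (tendsto_id.const_mul_atTop' Module.finrank_pos)).div_const _)
  rw [one_div] at h
  refine tendsto_of_tendsto_of_tendsto_of_le_of_le' h tendsto_const_nhds ?_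
    (.of_forall fun p ↦ conicConst_le 𝕜 d p)
  filter_upwards [eventually_ne_atTop 0] with p hp
  have : NeZero p := ⟨hp⟩
  exact le_conicConst 𝕜 d p

lemma inv_gaussRatio_finrank_real_mul (d : ℕ) : (gaussRatio (Module.finrank ℝ ℝ * d))⁻¹ =
    d * Real.Gamma (d / 2) ^ 2 / (2 * Real.Gamma ((d + 1) / 2) ^ 2) := by
  rw [Module.finrank_self, one_mul, gaussRatio, gaussMeanNorm, div_pow, mul_pow,
    Real.sq_sqrt zero_le_two, div_div, inv_div, mul_comm]

lemma inv_gaussRatio_finrank_complex_mul (d : ℕ) : (gaussRatio (Module.finrank ℝ ℂ * d))⁻¹ =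
    d * Real.Gamma d ^ 2 / Real.Gamma ((2 * d + 1) / 2) ^ 2 := by
  rw [Complex.finrank_real_complex, gaussRatio, gaussMeanNorm, div_pow, mul_pow,
    Real.sq_sqrt zero_le_two, Nat.cast_mul, Nat.cast_two, mul_div_cancel_left₀ _ two_ne_zero,
    div_div, inv_div, mul_left_comm, mul_div_mul_left _ _ two_ne_zero, mul_comm]

lemma inv_gaussRatio_finrank_real_one : (gaussRatio (Module.finrank ℝ ℝ * 1))⁻¹ = Real.pi / 2 := by
  rw [inv_gaussRatio_finrank_real_mul]
  norm_num [Real.Gamma_one_half_eq, Real.sq_sqrt Real.pi_pos.le]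

lemma inv_gaussRatio_finrank_complex_one :
    (gaussRatio (Module.finrank ℝ ℂ * 1))⁻¹ = 4 / Real.pi := by
  have h : Real.Gamma (3 / 2) = 1 / 2 * √Real.pi := by
    rw [← Real.Gamma_one_half_eq, ← Real.Gamma_add_one (by norm_num)]
    norm_num
  rw [inv_gaussRatio_finrank_complex_mul]
  norm_num [h, mul_pow, Real.sq_sqrt Real.pi_pos.le]
  field_simp

end GaussRatio

theorem proposition5p6 :
    -- lower bounds for finite `p`
    (∀ d p : ℕ, 1 ≤ d → d ≤ p →
      ENNReal.ofReal ((d : ℝ) / (p : ℝ) *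
          (Real.Gamma (((p : ℝ) + 1) / 2) * Real.Gamma ((d : ℝ) / 2) /
            (Real.Gamma ((p : ℝ) / 2) * Real.Gamma (((d : ℝ) + 1) / 2))) ^ 2)
        ≤ conicConst (psdCones ℝ) d p ∧
      ENNReal.ofReal ((d : ℝ) / (p : ℝ) *
          (Real.Gamma ((2 * (p : ℝ) + 1) / 2) * Real.Gamma (d : ℝ) /
            (Real.Gamma (p : ℝ) * Real.Gamma ((2 * (d : ℝ) + 1) / 2))) ^ 2)
        ≤ conicConst (psdCones ℂ) d p) ∧
    -- the limits `K_{C,d,∞}` of `K_{C,d,p}` as `p → ∞` exist and have the stated values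
    (∀ d : ℕ, 1 ≤ d →
      Tendsto (fun p : ℕ => conicConst (psdCones ℝ) d p) atTop
        (𝓝 (ENNReal.ofReal ((d : ℝ) * Real.Gamma ((d : ℝ) / 2) ^ 2 /
          (2 * Real.Gamma (((d : ℝ) + 1) / 2) ^ 2)))) ∧
      Tendsto (fun p : ℕ => conicConst (psdCones ℂ) d p) atTop
        (𝓝 (ENNReal.ofReal ((d : ℝ) * Real.Gamma (d : ℝ) ^ 2 /
          Real.Gamma ((2 * (d : ℝ) + 1) / 2) ^ 2)))) ∧
    -- the resulting inequalities between the `γ`- and the `(γ, d)`-seminorm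
    (∀ d : ℕ, 1 ≤ d → ∀ n : ℕ,
      (∀ A ∈ psdCones ℝ n, gammaSeminormFull A ≤
        (d : ℝ) * Real.Gamma ((d : ℝ) / 2) ^ 2 / (2 * Real.Gamma (((d : ℝ) + 1) / 2) ^ 2) *
          gammaSeminorm d A) ∧
      (∀ A ∈ psdCones ℂ n, gammaSeminormFull A ≤
        (d : ℝ) * Real.Gamma (d : ℝ) ^ 2 / Real.Gamma ((2 * (d : ℝ) + 1) / 2) ^ 2 *
          gammaSeminorm d A)) ∧
    -- the case `d = 1`: the sharp constants `π / 2` and `4 / π`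
    (Tendsto (fun p : ℕ => conicConst (psdCones ℝ) 1 p) atTop
        (𝓝 (ENNReal.ofReal (Real.pi / 2))) ∧
      Tendsto (fun p : ℕ => conicConst (psdCones ℂ) 1 p) atTop
        (𝓝 (ENNReal.ofReal (4 / Real.pi))) ∧
      ∀ n : ℕ,
        (∀ A ∈ psdCones ℝ n, gammaSeminormFull A ≤ Real.pi / 2 * gammaSeminorm 1 A) ∧
        (∀ A ∈ psdCones ℂ n, gammaSeminormFull A ≤ 4 / Real.pi * gammaSeminorm 1 A)) := by
  simp only [← inv_gaussRatio_finrank_real_mul, ← inv_gaussRatio_finrank_complex_mul,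
    ← inv_gaussRatio_finrank_real_one, ← inv_gaussRatio_finrank_complex_one]
  refine ⟨fun d p hd hdp ↦ ?lower, fun d hd ↦ ?limit, fun d hd n ↦ ?upper,
    tendsto_conicConst ℝ 1, tendsto_conicConst ℂ 1, fun n ↦
      ⟨fun A ↦ gammaSeminorm_le_of_mem_psdCones, fun A ↦ gammaSeminorm_le_of_mem_psdCones⟩⟩
  all_goals have : NeZero d := ⟨by lia⟩
  case lower =>
    have : NeZero p := ⟨by lia⟩
    have hℝ := le_conicConst ℝ d p
    have hℂ := le_conicConst ℂ d p
    rw [← inv_div_inv, inv_gaussRatio_finrank_real_mul, inv_gaussRatio_finrank_real_mul] at hℝ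
    rw [← inv_div_inv, inv_gaussRatio_finrank_complex_mul, inv_gaussRatio_finrank_complex_mul] at hℂ
    refine ⟨le_of_eq_of_le (congrArg ENNReal.ofReal ?_) hℝ,
      le_of_eq_of_le (congrArg ENNReal.ofReal ?_) hℂ⟩ <;> field_simp
  case limit => exact ⟨tendsto_conicConst ℝ d, tendsto_conicConst ℂ d⟩
  case upper =>
    exact ⟨fun A ↦ gammaSeminorm_le_of_mem_psdCones, fun A ↦ gammaSeminorm_le_of_mem_psdCones⟩
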